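/- Let $m\ge 1$, $d\ge 0$ and $1\le w\le n/2$ be integers. An MCWC$(m,n,2d,w)$ is a binary code $C$ of length $mn$, whose coordinates are partitioned into $m$ blocks of size $n$, such that every codeword has weight $w$ in each block and any two distinct codewords have Hamming distance at least $2d$; $M(m,n,2d,w)$ is the largest size of such a code. For a nonempty code $C$ of this kind and $0\le i_1,\dots,i_m\le w$, let $A_{2i_1,\dots,2i_m}(C)$ be the average, over $c\in C$, of the number of $c'\in C$ that differ from $c$ in exactly $2i_j$ coordinates of block $j$ for every $j=1,\dots,m$. Let $X$ be the set of binary words of length $n$ and weight $w$, and let $D_0,\dots,D_w$ be the adjacency matrices of the Johnson scheme $J(w,n)$ on $X$, i.e. $D_i(x,y)=1$ if $x$ and $y$ are at Hamming distance $2i$, and $D_i(x,y)=0$ otherwise. Let $J_0,\dots,J_w$ be the pairwise orthogonal idempotents (in any order) that form a basis of the linear span of $D_0,\dots,D_w$ over $\mathbb{C}$. The eigenmatrices $P=[P_k(i)]_{i,k}$ and $Q=[Q_k(i)]_{i,k}$, with row index $i$ and column index $k$, are defined by $D_k=\sum_{i=0}^w P_k(i)J_i$ and $PQ=QP=|X|I$.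 (a) For every nonempty MCWC$(m,n,2d,w)$ $C$ and all $0\le k_1,\dots,k_m\le w$, $$\sum_{i_1=0}^{w}\cdots\sum_{i_m=0}^{w}Q_{k_1}(i_1)\cdots Q_{k_m}(i_m)\,A_{2i_1,\dots,2i_m}(C)\ \ge 0 .$$ (b) $$M(m,n,2d,w)\le 1+\Big\lfloor \max \sum_{(i_1,\dots,i_m)\ne(0,\dots,0)}A_{2i_1,\dots,2i_m}\Big\rfloor ,$$ where the maximum exists and is taken over all real families $(A_{2i_1,\dots,2i_m})_{0\le i_1,\dots,i_m\le w}$ such that $A_{0,\dots,0}=1$; $A_{2i_1,\dots,2i_m}\ge 0$ for all $(i_1,\dots,i_m)$; $A_{2i_1,\dots,2i_m}=0$ for all $(i_1,\dots,i_m)\neq(0,\dots,0)$ with $\sum_{j}i_j<d$; and $$\sum_{i_1=0}^{w}\cdots\sum_{i_m=0}^{w}Q_{k_1}(i_1)\cdots Q_{k_m}(i_m)\,A_{2i_1,\dots,2i_m}\ge 0\quad\text{for all } 0\le k_1,\dots,k_m\le w .$$ -/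

import Mathlib

open scoped ComplexOrder

/-! ### Multiply constant-weight codes -/

/-- `C` is an MCWC`(m, n, d, w)`: a binary code on the coordinate set `Fin m × Fin n`, partitioned
into the `m` blocks `{j} × Fin n`, each codeword having weight `w` in every block, and any two
distinct codewords having Hamming distance at least `d`. -/
def IsMCWC (m n d w : ℕ) (C : Finset (Fin m × Fin n → ZMod 2)) : Prop :=
  (∀ u ∈ C, ∀ j : Fin m, hammingNorm (fun x : Fin n => u (j, x)) = w) ∧
    ∀ u ∈ C, ∀ v ∈ C, u ≠ v → d ≤ hammingDist u v

open Classical in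
/-- `M(m, n, d, w)`: the largest size of an MCWC`(m, n, d, w)`. -/
noncomputable def maxMCWC (m n d w : ℕ) : ℕ :=
  (Finset.univ.filter fun C : Finset (Fin m × Fin n → ZMod 2) => IsMCWC m n d w C).sup Finset.card

open Classical in
/-- The distance distribution: `mcwcDistr C i` is `A_{2i₁,…,2iₘ}`, the average over `c ∈ C` of the
number of `c₁ ∈ C` at distance `2 iⱼ` from `c` in block `j`, for every `j`. -/
noncomputable def mcwcDistr {m n : ℕ} (w : ℕ) (C : Finset (Fin m × Fin n → ZMod 2))
    (i : Fin m → Fin (w + 1)) : ℝ :=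
  (1 / (C.card : ℝ)) * ∑ c ∈ C, ((C.filter fun c₁ =>
    ∀ j : Fin m, hammingDist (fun x : Fin n => c₁ (j, x)) (fun x => c (j, x)) =
      2 * (i j : ℕ)).card : ℝ)

/-! ### Eigenmatrices of an association scheme, and the Johnson scheme -/

open Classical in
/-- The adjacency matrix of a relation. -/
noncomputable def relMatrix {X : Type*} (R : X → X → Prop) : Matrix X X ℂ :=
  Matrix.of fun x y => if R x y then 1 else 0

/-- `P` and `Q` are the eigenmatrices of the scheme with relations `R k`, `k : ι`, with respect to
some ordering `J` of the pairwise orthogonal idempotents that form a basis of the Bose-Mesner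
algebra. The entry `P i k` is `P_k(i)`, and `Q i k` is `Q_k(i)`. -/
def IsEigenmatrixPair {X ι : Type*} [Fintype X] [DecidableEq X] [Fintype ι] [DecidableEq ι]
    (R : ι → X → X → Prop) (P Q : Matrix ι ι ℂ) : Prop :=
  (∃ J : ι → Matrix X X ℂ,
    (∀ i, J i * J i = J i) ∧
    (∀ i j, i ≠ j → J i * J j = 0) ∧
    LinearIndependent ℂ J ∧
    Submodule.span ℂ (Set.range J) = Submodule.span ℂ (Set.range fun k => relMatrix (R k)) ∧
    ∀ k, relMatrix (R k) = ∑ i, P i k • J i) ∧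
  P * Q = (Fintype.card X : ℂ) • (1 : Matrix ι ι ℂ) ∧
  Q * P = (Fintype.card X : ℂ) • (1 : Matrix ι ι ℂ)

/-- The point set of the Johnson scheme `J(w, n)`: binary words of length `n` and weight `w`. -/
abbrev JohnsonPoint (n w : ℕ) : Type := {x : Fin n → ZMod 2 // hammingNorm x = w}

/-- The relations `R₀, …, R_w` of the Johnson scheme: `(x, y) ∈ Rᵢ` iff `d(x, y) = 2i`. -/
def johnsonRel (n w : ℕ) (i : Fin (w + 1)) (x y : JohnsonPoint n w) : Prop :=
  hammingDist x.1 y.1 = 2 * (i : ℕ)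

/-! ### The linear program -/

/-- The Delsarte inequalities of the product of `m` Johnson schemes:
`∑_{i₁,…,iₘ} Q_{k₁}(i₁) ⋯ Q_{kₘ}(iₘ) A_{2i₁,…,2iₘ} ≥ 0` for all `k₁, …, kₘ`
(in the order of `ℂ`, where `0 ≤ z` says that `z` is a nonnegative real). -/
def DelsarteIneq {m w : ℕ} (Q : Matrix (Fin (w + 1)) (Fin (w + 1)) ℂ)
    (A : (Fin m → Fin (w + 1)) → ℝ) : Prop :=
  ∀ k : Fin m → Fin (w + 1),
    0 ≤ ∑ i : Fin m → Fin (w + 1), (∏ j, Q (i j) (k j)) * (A i : ℂ)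

/-- Feasible points of the linear program: `A i` stands for `A_{2i₁,…,2iₘ}`. The entry at
`(0, …, 0)` counts the codeword itself and is `1`. -/
def LPFeasible {m w : ℕ} (d : ℕ) (Q : Matrix (Fin (w + 1)) (Fin (w + 1)) ℂ)
    (A : (Fin m → Fin (w + 1)) → ℝ) : Prop :=
  A 0 = 1 ∧
  (∀ i, 0 ≤ A i) ∧
  (∀ i, i ≠ 0 → ∑ j, (i j : ℕ) < d → A i = 0) ∧
  DelsarteIneq Q A

/-- The values of the objective function `∑_{i ≠ 0} A_{2i₁,…,2iₘ}` on the feasible points. -/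
def lpValues (m w d : ℕ) (Q : Matrix (Fin (w + 1)) (Fin (w + 1)) ℂ) : Set ℝ :=
  {v | ∃ A : (Fin m → Fin (w + 1)) → ℝ, LPFeasible d Q A ∧
    v = ∑ i ∈ Finset.univ.filter (fun i => i ≠ 0), A i}

/-! ### Eigenmatrices of the Johnson scheme exist -/

/-- A commutative reduced finite-dimensional `ℂ`-algebra with a basis indexed by `ι` has a basis of
pairwise orthogonal idempotents indexed by `ι`. -/
theorem exists_orthogonal_idempotent_basis {ι S : Type*} [Fintype ι] [CommRing S]
    [Algebra ℂ S] [IsReduced S] (b : Module.Basis ι ℂ S) :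
    ∃ J : Module.Basis ι ℂ S, (∀ i, J i * J i = J i) ∧ ∀ i j, i ≠ j → J i * J j = 0 := by
  classical
  have hfin : Module.Finite ℂ S := Module.Finite.of_basis b
  have hart : IsArtinianRing S := IsArtinianRing.of_finite ℂ S
  let T := MaximalSpectrum S
  have hT : Finite T := inferInstance
  have : Fintype T := Fintype.ofFinite T
  let e := IsArtinianRing.equivPi S
  let J : T → S := fun M => e.symm (Pi.single M 1)
  have hJJ : ∀ M, J M * J M = J M := by
    intro M
    simp only [J, ← map_mul, ← Pi.single_mul, mul_one]
  have hJ0 : ∀ M N, M ≠ N → J M * J N = 0 := by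
    intro M N hMN
    simp only [J, ← map_mul]
    have : (Pi.single M 1 : ∀ I : T, S ⧸ I.asIdeal) * Pi.single N 1 = 0 := by
      funext L
      by_cases hL : L = M
      · subst hL
        simp [Pi.single_eq_of_ne hMN]
      · simp [Pi.single_eq_of_ne hL]
    rw [this, map_zero]
  have hne : ∀ M, J M ≠ 0 := by
    intro M h
    have h1 : (Pi.single M 1 : ∀ I : T, S ⧸ I.asIdeal) = 0 := by
      simp only [J, map_eq_zero_iff e.symm e.symm.injective] at h
      exact h
    have h2 := congrFun h1 M
    have := M.isMaximal
    have := Ideal.Quotient.nontrivial_iff.mpr (Ideal.IsMaximal.ne_top (I := M.asIdeal) this)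
    simp at h2
  have hli : LinearIndependent ℂ J := by
    rw [Fintype.linearIndependent_iff]
    intro g hg M
    have h1 := congrArg (fun x => J M * x) hg
    simp only [Finset.mul_sum, mul_zero] at h1
    rw [Finset.sum_eq_single M] at h1
    · rw [mul_smul_comm, hJJ] at h1
      exact (smul_eq_zero.mp h1).resolve_right (hne M)
    · intro N _ hN
      rw [mul_smul_comm, hJ0 M N hN.symm, smul_zero]
    · simp
  have hsp : ⊤ ≤ Submodule.span ℂ (Set.range J) := by
    intro x _
    have hc : ∀ M : T, ∃ c : ℂ, (Ideal.Quotient.mk M.asIdeal (algebraMap ℂ S c)) =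
        Ideal.Quotient.mk M.asIdeal x := by
      intro M
      have := M.isMaximal
      obtain ⟨c, hc⟩ := (IsAlgClosed.algebraMap_bijective_of_isIntegral
        (k := ℂ) (K := S ⧸ M.asIdeal)).2 (Ideal.Quotient.mk M.asIdeal x)
      exact ⟨c, hc⟩
    choose c hc using hc
    have hx : x = ∑ M, c M • J M := by
      apply e.injective
      rw [map_sum]
      funext N
      rw [Finset.sum_apply, Finset.sum_eq_single N]
      · rw [Algebra.smul_def, map_mul]
        simp only [J, AlgEquiv.apply_symm_apply, Pi.mul_apply, Pi.single_eq_same, mul_one]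
        exact (hc N).symm
      · intro M _ hM
        rw [Algebra.smul_def, map_mul]
        simp only [J, AlgEquiv.apply_symm_apply, Pi.mul_apply, Pi.single_eq_of_ne hM.symm, mul_zero]
      · simp
    rw [hx]
    exact Submodule.sum_mem _ fun M _ => Submodule.smul_mem _ _ (Submodule.subset_span ⟨M, rfl⟩)
  let B := Module.Basis.mk hli hsp
  let f : T ≃ ι := B.indexEquiv b
  refine ⟨B.reindex f, ?_, ?_⟩
  · intro i
    simp [B, hJJ]
  · intro i j hij
    simp [B]
    exact hJ0 _ _ (fun h => hij (f.symm.injective h))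

/-- Linearly independent, symmetric `0/1` adjacency matrices whose span contains the identity and
is closed under multiplication have a pair of eigenmatrices. -/
theorem exists_isEigenmatrixPair {X ι : Type*} [Fintype X] [DecidableEq X] [Fintype ι]
    [DecidableEq ι] (R : ι → X → X → Prop) (hsymm : ∀ k x y, R k x y → R k y x)
    (hli : LinearIndependent ℂ fun k => relMatrix (R k))
    (hone : (1 : Matrix X X ℂ) ∈ Submodule.span ℂ (Set.range fun k => relMatrix (R k)))
    (hmul : ∀ i j, relMatrix (R i) * relMatrix (R j) ∈
      Submodule.span ℂ (Set.range fun k => relMatrix (R k))) :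
    ∃ P Q : Matrix ι ι ℂ, IsEigenmatrixPair R P Q := by
  classical
  set D : ι → Matrix X X ℂ := fun k => relMatrix (R k) with hD
  set V := Submodule.span ℂ (Set.range D) with hV
  have hDt : ∀ k, (D k).transpose = D k := by
    intro k
    ext x y
    simp only [hD, relMatrix, Matrix.transpose_apply, Matrix.of_apply]
    congr 1
    exact propext ⟨hsymm k _ _, hsymm k _ _⟩
  have hDh : ∀ k, (D k).conjTranspose = D k := by
    intro k
    ext x y
    have h := congrFun (congrFun (hDt k) x) y
    rw [Matrix.transpose_apply] at h
    rw [Matrix.conjTranspose_apply, h]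
    simp only [hD, relMatrix, Matrix.of_apply]
    split_ifs <;> simp
  have hmulV : ∀ A B, A ∈ V → B ∈ V → A * B ∈ V := by
    intro A B hA hB
    induction hA using Submodule.span_induction with
    | mem x hx =>
      obtain ⟨i, rfl⟩ := hx
      induction hB using Submodule.span_induction with
      | mem y hy =>
        obtain ⟨j, rfl⟩ := hy
        exact hmul i j
      | zero => simp
      | add y z _ _ h1 h2 => rw [mul_add]; exact V.add_mem h1 h2
      | smul c y _ h => rw [mul_smul_comm]; exact V.smul_mem c h
    | zero => simp
    | add y z _ _ h1 h2 => rw [add_mul]; exact V.add_mem h1 h2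
    | smul c y _ h => rw [smul_mul_assoc]; exact V.smul_mem c h
  have htV : ∀ A ∈ V, A.transpose = A := by
    intro A hA
    induction hA using Submodule.span_induction with
    | mem x hx => obtain ⟨i, rfl⟩ := hx; exact hDt i
    | zero => simp
    | add y z _ _ h1 h2 => rw [Matrix.transpose_add, h1, h2]
    | smul c y _ h => rw [Matrix.transpose_smul, h]
  have hhV : ∀ A ∈ V, A.conjTranspose ∈ V := by
    intro A hA
    induction hA using Submodule.span_induction with
    | mem x hx => obtain ⟨i, rfl⟩ := hx; rw [hDh i]; exact Submodule.subset_span ⟨i, rfl⟩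
    | zero => simp
    | add y z _ _ h1 h2 => rw [Matrix.conjTranspose_add]; exact V.add_mem h1 h2
    | smul c y _ h => rw [Matrix.conjTranspose_smul]; exact V.smul_mem _ h
  have hcomm : ∀ A B, A ∈ V → B ∈ V → A * B = B * A := by
    intro A B hA hB
    rw [← htV _ (hmulV A B hA hB), Matrix.transpose_mul, htV A hA, htV B hB]
  let S : Subalgebra ℂ (Matrix X X ℂ) := V.toSubalgebra hone hmulV
  have hS : ∀ A : S, (A : Matrix X X ℂ) ∈ V := fun A => A.2
  let _ : CommRing S := { (inferInstance : Ring S) with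
    mul_comm := fun A B => Subtype.ext (hcomm A B (hS A) (hS B)) }
  have hred : IsReduced S := by
    rw [isReduced_iff_pow_one_lt 2 (by norm_num)]
    intro A hA
    have hA' : (A : Matrix X X ℂ) * A = 0 := by
      have := congrArg (Subtype.val) hA
      rw [pow_two] at this
      exact this
    apply Subtype.ext
    change (A : Matrix X X ℂ) = 0
    rw [← Matrix.conjTranspose_mul_self_eq_zero, ← Matrix.conjTranspose_mul_self_eq_zero,
      Matrix.conjTranspose_mul, Matrix.conjTranspose_conjTranspose,
      hcomm _ _ (hhV _ (hS A)) (hS A), mul_assoc, ← mul_assoc (A : Matrix X X ℂ).conjTranspose,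
      hcomm _ _ (hhV _ (hS A)) (hS A), mul_assoc, ← mul_assoc, hA', zero_mul]
  let b : Module.Basis ι ℂ S := Module.Basis.span hli
  have hb : ∀ k, ((b k : S) : Matrix X X ℂ) = D k := fun k =>
    congrArg Subtype.val (Module.Basis.span_apply hli k)
  obtain ⟨J, hJJ, hJ0⟩ := exists_orthogonal_idempotent_basis b
  have hPinv : J.toMatrix b * b.toMatrix J = 1 := Module.Basis.toMatrix_mul_toMatrix_flip J b
  have hPinv' : b.toMatrix J * J.toMatrix b = 1 := Module.Basis.toMatrix_mul_toMatrix_flip b J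
  refine ⟨J.toMatrix b, (Fintype.card X : ℂ) • b.toMatrix J,
    ⟨fun i => (J i : Matrix X X ℂ), ?_, ?_, ?_, ?_, ?_⟩, ?_, ?_⟩
  · intro i
    exact congrArg Subtype.val (hJJ i)
  · intro i j hij
    exact congrArg Subtype.val (hJ0 i j hij)
  · exact J.linearIndependent.map' S.val.toLinearMap
      (LinearMap.ker_eq_bot.mpr Subtype.val_injective)
  · have h1 : Set.range (fun i => (J i : Matrix X X ℂ)) = S.val.toLinearMap '' Set.range J := by
      rw [← Set.range_comp]; rfl
    rw [h1, Submodule.span_image, J.span_eq, Submodule.map_top]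
    ext A
    simp only [LinearMap.mem_range]
    constructor
    · rintro ⟨B, rfl⟩
      exact hS B
    · intro hA
      exact ⟨⟨A, hA⟩, rfl⟩
  · intro k
    have h := congrArg S.val.toLinearMap (J.sum_toMatrix_smul_self (v := b) k)
    rw [map_sum] at h
    simp only [map_smul] at h
    exact ((hb k).symm.trans h.symm)
  · rw [Matrix.mul_smul, hPinv]
  · rw [Matrix.smul_mul, hPinv']

/-- Two functions on a finite type with fibres of the same sizes differ by a permutation. -/
theorem exists_perm_comp_eq {α β : Type*} [Fintype α] [DecidableEq β] (f g : α → β)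
    (h : ∀ b, (Finset.univ.filter fun a => f a = b).card =
      (Finset.univ.filter fun a => g a = b).card) :
    ∃ σ : Equiv.Perm α, ∀ a, g (σ a) = f a := by
  have h' : ∀ b, Nonempty ({a // f a = b} ≃ {a // g a = b}) := by
    intro b
    refine ⟨Fintype.equivOfCardEq ?_⟩
    rw [Fintype.card_subtype, Fintype.card_subtype, h b]
  refine ⟨(Equiv.sigmaFiberEquiv f).symm.trans
    ((Equiv.sigmaCongrRight fun b => (h' b).some).trans (Equiv.sigmaFiberEquiv g)), ?_⟩
  intro a
  exact ((h' (f a)).some ⟨a, rfl⟩).2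

/-- The sizes of the four cells cut out by two binary words of weight `w`. -/
theorem johnsonPoint_cells {n w : ℕ} (x y : JohnsonPoint n w) :
    let c := fun b : ZMod 2 × ZMod 2 => (Finset.univ.filter fun a => (x.1 a, y.1 a) = b).card
    c (0, 0) + c (0, 1) + c (1, 0) + c (1, 1) = n ∧ c (1, 0) + c (1, 1) = w ∧
      c (0, 1) + c (1, 1) = w ∧ c (0, 1) + c (1, 0) = hammingDist x.1 y.1 := by
  intro c
  have key : ∀ p : ZMod 2 × ZMod 2 → Prop, ∀ _ : DecidablePred p,
      (Finset.univ.filter fun a => p (x.1 a, y.1 a)).card =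
        ∑ b : ZMod 2 × ZMod 2, if p b then c b else 0 := by
    intro p _
    rw [Finset.card_eq_sum_card_fiberwise (f := fun a => (x.1 a, y.1 a)) (t := Finset.univ)
      (fun _ _ => by simp)]
    refine Finset.sum_congr rfl fun b _ => ?_
    split_ifs with hb
    · rw [Finset.filter_filter]
      congr 1
      ext a
      simp only [Finset.mem_filter, Finset.mem_univ, true_and]
      exact ⟨fun h => h.2, fun h => ⟨h ▸ hb, h⟩⟩
    · rw [Finset.card_eq_zero, Finset.filter_eq_empty_iff]
      intro a ha h
      rw [Finset.mem_filter] at ha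
      exact hb (h ▸ ha.2)
  have hs : ∀ g : ZMod 2 × ZMod 2 → ℕ, ∑ b, g b = g (0, 0) + g (0, 1) + (g (1, 0) + g (1, 1)) := by
    intro g
    rw [Fintype.sum_prod_type]
    have h2 : ∀ k : ZMod 2 → ℕ, ∑ b, k b = k 0 + k 1 := fun k => Fin.sum_univ_two k
    rw [h2, h2, h2]
  have h1 := key (fun _ => True) inferInstance
  have h2 := key (fun b => b.1 ≠ 0) inferInstance
  have h3 := key (fun b => b.2 ≠ 0) inferInstance
  have h4 := key (fun b => b.1 ≠ b.2) inferInstance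
  rw [hs] at h1 h2 h3 h4
  have hx := x.2
  have hy := y.2
  simp only [hammingNorm] at hx hy
  simp only [hammingDist]
  simp at h1 h2 h3 h4
  simp at hx hy
  rw [hx] at h2
  rw [hy] at h3
  rw [h4]
  refine ⟨by omega, by omega, by omega, by omega⟩

/-- Eigenmatrices of the Johnson scheme exist. -/
theorem johnson_exists_isEigenmatrixPair {n w : ℕ} (hwn : 2 * w ≤ n) :
    ∃ P Q, IsEigenmatrixPair (johnsonRel n w) P Q := by
  classical
  have hcov : ∀ x y : JohnsonPoint n w, ∃ k, johnsonRel n w k x y := by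
    intro x y
    obtain ⟨h1, h2, h3, h4⟩ := johnsonPoint_cells x y
    beta_reduce at h1 h2 h3 h4
    refine ⟨⟨(Finset.univ.filter fun a => (x.1 a, y.1 a) = (1, 0)).card, by omega⟩, ?_⟩
    simp only [johnsonRel]
    omega
  have huniq : ∀ k l (x y : JohnsonPoint n w), johnsonRel n w k x y → johnsonRel n w l x y →
      k = l := by
    intro k l x y h1 h2
    simp only [johnsonRel] at h1 h2
    ext
    omega
  have hne : ∀ k, ∃ x y, johnsonRel n w k x y := by
    intro k
    have hk := k.2
    have hc : ∀ s : Finset (Fin n), s.card = w →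
        hammingNorm (fun a => if a ∈ s then (1 : ZMod 2) else 0) = w := by
      intro s hs
      simp [hammingNorm, hs]
    obtain ⟨U, -, hU⟩ := Finset.exists_subset_card_eq (s := (Finset.univ : Finset (Fin n)))
      (n := w + k) (by simp; omega)
    obtain ⟨s, hsU, hs⟩ := Finset.exists_subset_card_eq (s := U) (n := w) (by omega)
    obtain ⟨r, hrs, hr⟩ := Finset.exists_subset_card_eq (s := s) (n := w - k) (by omega)
    have hd : (U \ s).card = k := by rw [Finset.card_sdiff_of_subset hsU]; omega
    have hdisj : Disjoint r (U \ s) :=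
      Finset.disjoint_of_subset_left hrs Finset.disjoint_sdiff
    have ht : (r ∪ (U \ s)).card = w := by rw [Finset.card_union_of_disjoint hdisj]; omega
    refine ⟨⟨_, hc s hs⟩, ⟨_, hc _ ht⟩, ?_⟩
    have hsr : (s \ r).card = k := by rw [Finset.card_sdiff_of_subset hrs]; omega
    have hE : (Finset.univ.filter fun a => (if a ∈ s then (1 : ZMod 2) else 0) ≠
        if a ∈ r ∪ (U \ s) then 1 else 0) = (s \ r) ∪ (U \ s) := by
      ext a
      have := @hrs a
      by_cases h1 : a ∈ s <;> by_cases h2 : a ∈ r <;> by_cases h3 : a ∈ U <;> simp_all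
    simp only [johnsonRel, hammingDist]
    rw [hE, Finset.card_union_of_disjoint, hsr, hd]
    · omega
    · exact Finset.disjoint_of_subset_left Finset.sdiff_subset Finset.disjoint_sdiff
  have hcomb : ∀ (c : Fin (w + 1) → ℂ) k (x y : JohnsonPoint n w), johnsonRel n w k x y →
      (∑ l, c l • relMatrix (johnsonRel n w l)) x y = c k := by
    intro c k x y h
    rw [Matrix.sum_apply, Finset.sum_eq_single k]
    · simp [relMatrix, h]
    · intro l _ hl
      have : ¬ johnsonRel n w l x y := fun h' => hl (huniq _ _ _ _ h' h)
      simp [relMatrix, this]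
    · simp
  have hmem : ∀ A : Matrix (JohnsonPoint n w) (JohnsonPoint n w) ℂ,
      (∀ k x y x' y', johnsonRel n w k x y → johnsonRel n w k x' y' → A x y = A x' y') →
      A ∈ Submodule.span ℂ (Set.range fun k => relMatrix (johnsonRel n w k)) := by
    intro A hA
    choose u v huv using hne
    have : A = ∑ l, A (u l) (v l) • relMatrix (johnsonRel n w l) := by
      ext x y
      obtain ⟨k, hk⟩ := hcov x y
      rw [hcomb (fun l => A (u l) (v l)) k x y hk]
      exact hA k _ _ _ _ hk (huv k)
    rw [this]
    exact Submodule.sum_mem _ fun M _ => Submodule.smul_mem _ _ (Submodule.subset_span ⟨M, rfl⟩)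
  refine exists_isEigenmatrixPair _ ?_ ?_ ?_ ?_
  · intro k x y h
    simp only [johnsonRel] at h ⊢
    rw [hammingDist_comm, h]
  · rw [Fintype.linearIndependent_iff]
    intro c hc k
    obtain ⟨x, y, h⟩ := hne k
    rw [← hcomb c k x y h, hc]
    rfl
  · apply hmem
    intro k x y x' y' h h'
    simp only [johnsonRel] at h h'
    have e1 : x = y ↔ (k : ℕ) = 0 := by
      rw [Subtype.ext_iff, ← hammingDist_eq_zero, h]; omega
    have e2 : x' = y' ↔ (k : ℕ) = 0 := by
      rw [Subtype.ext_iff, ← hammingDist_eq_zero, h']; omega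
    simp only [Matrix.one_apply, e1, e2]
  · intro i j
    apply hmem
    intro k x y x' y' h h'
    simp only [johnsonRel] at h h'
    obtain ⟨a1, a2, a3, a4⟩ := johnsonPoint_cells x y
    obtain ⟨b1, b2, b3, b4⟩ := johnsonPoint_cells x' y'
    beta_reduce at a1 a2 a3 a4 b1 b2 b3 b4
    obtain ⟨σ, hσ⟩ := exists_perm_comp_eq (fun a => (x.1 a, y.1 a)) (fun a => (x'.1 a, y'.1 a)) (by
      have hz : ∀ z : ZMod 2, z = 0 ∨ z = 1 := by decide
      rintro ⟨p, q⟩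
      rcases hz p with rfl | rfl <;> rcases hz q with rfl | rfl <;> omega)
    have hx : ∀ a, x'.1 (σ a) = x.1 a := fun a => congrArg Prod.fst (hσ a)
    have hy : ∀ a, y'.1 (σ a) = y.1 a := fun a => congrArg Prod.snd (hσ a)
    have hdist : ∀ u v : Fin n → ZMod 2, hammingDist (fun a => u (σ a)) (fun a => v (σ a)) =
        hammingDist u v := by
      intro u v
      exact Finset.card_equiv σ (by simp)
    have hnorm : ∀ u : Fin n → ZMod 2, hammingNorm (fun a => u (σ a)) = hammingNorm u := by
      intro u
      exact Finset.card_equiv σ (by simp)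
    let τ : JohnsonPoint n w ≃ JohnsonPoint n w :=
      { toFun := fun z => ⟨fun a => z.1 (σ a), by rw [hnorm]; exact z.2⟩
        invFun := fun z => ⟨fun a => z.1 (σ.symm a), by rw [← hnorm]; simpa using z.2⟩
        left_inv := fun z => by ext a; simp
        right_inv := fun z => by ext a; simp }
    have hτx : τ x' = x := Subtype.ext (funext hx)
    have hτy : τ y' = y := Subtype.ext (funext hy)
    have hR : ∀ l z z', johnsonRel n w l (τ z) (τ z') = johnsonRel n w l z z' := by
      intro l z z'
      simp only [johnsonRel, τ, Equiv.coe_fn_mk]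
      rw [hdist]
    rw [Matrix.mul_apply, Matrix.mul_apply, ← τ.sum_comp]
    refine Finset.sum_congr rfl fun z _ => ?_
    simp only [relMatrix, Matrix.of_apply]
    rw [← hτx, ← hτy, hR, hR]

/-! ### Idempotents of a symmetric scheme are positive semidefinite -/

section Eigenmatrix

variable {X ι : Type*}

/-! For (a), inverting `P` gives `∑ i, Q i k • D i = |X| • J k`, and `J k` turns out to be
Hermitian, hence a Gram matrix `Nᴴ * N`. The distance distribution sums, over pairs of codewords, a
product over the blocks of entries of the matrices `D i`. Its `Q`-transform at `k` is therefore a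
positive multiple of the sum over all pairs of codewords of a product of Gram kernels, one per
block. Such a product is the Gram kernel of a tensor product, so the sum is nonnegative
(`IsMCWC.delsarteIneq`).

For (b), the distribution of a largest code is feasible and has objective value `|C| - 1`. The
maximum exists because the feasible set is compact: the transforms of a feasible point are
nonnegative with a fixed sum, so inverting by `P` bounds every coordinate
(`LPFeasible.le_sum_norm`). -/

theorem relMatrix_conjTranspose {R : X → X → Prop} (h : ∀ x y, R x y → R y x) :
    (relMatrix R).conjTranspose = relMatrix R := by
  classical
  ext x y
  have : R x y ↔ R y x := ⟨h x y, h y x⟩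
  by_cases hxy : R y x <;> simp [relMatrix, this, hxy]

/-- A product of Gram kernels is a nonnegative kernel. -/
theorem sum_sum_prod_conjTranspose_mul_self_nonneg {κ S : Type*} [Fintype X]
    [Fintype κ] [DecidableEq κ] [Fintype S] (N : κ → Matrix X X ℂ) (f : S → κ → X) :
    0 ≤ ∑ s, ∑ t, ∏ j, ((N j).conjTranspose * N j) (f s j) (f t j) := by
  -- Expanding the product over `j` indexes the terms by `z : κ → X`; for each `z` the double sum
  -- over `s` and `t` factors as `star F * F`.
  have h : ∑ s, ∑ t, ∏ j, ((N j).conjTranspose * N j) (f s j) (f t j) =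
      ∑ z : κ → X, star (∑ s, ∏ j, N j (z j) (f s j)) * ∑ t, ∏ j, N j (z j) (f t j) := by
    simp only [Matrix.mul_apply, Fintype.prod_sum, Matrix.conjTranspose_apply,
      Finset.prod_mul_distrib, star_sum, Finset.sum_mul_sum, star_prod]
    simp only [Finset.sum_comm (s := (Finset.univ : Finset S))
      (t := (Finset.univ : Finset (κ → X)))]
  rw [h]
  exact Finset.sum_nonneg fun z _ => star_mul_self_nonneg _

variable [Fintype X] [DecidableEq X] [Fintype ι] [DecidableEq ι]

/-- The columns of the second eigenmatrix give the entries of positive semidefinite matrices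
of the form `|X| • (Nᴴ * N)`. -/
theorem IsEigenmatrixPair.exists_sum_eq_conjTranspose_mul_self {R : ι → X → X → Prop}
    {P Q : Matrix ι ι ℂ} (h : IsEigenmatrixPair R P Q) (hsymm : ∀ k x y, R k x y → R k y x)
    (k : ι) : ∃ N : Matrix X X ℂ,
      ∑ i, Q i k • relMatrix (R i) = (Fintype.card X : ℂ) • (N.conjTranspose * N) := by
  obtain ⟨⟨J, hJJ, hJ0, hli, -, hP⟩, hPQ, -⟩ := h
  have hne : J k ≠ 0 := hli.ne_zero k
  have hX : (Fintype.card X : ℂ) ≠ 0 := by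
    intro h0
    rw [Nat.cast_eq_zero, Fintype.card_eq_zero_iff] at h0
    exact hne (Subsingleton.elim _ _)
  -- `P * Q = |X| • 1` inverts the expansion of the adjacency matrices in the idempotents.
  have hsum : ∑ i, Q i k • relMatrix (R i) = (Fintype.card X : ℂ) • J k := by
    simp only [hP, Finset.smul_sum, smul_smul]
    rw [Finset.sum_comm]
    have h1 : ∀ l, ∑ i, (Q i k * P l i) • J l = (P * Q) l k • J l := by
      intro l
      rw [← Finset.sum_smul, Matrix.mul_apply]
      simp only [mul_comm]
    simp only [h1, hPQ, Matrix.smul_apply, Matrix.one_apply]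
    simp
  have hD : ∀ i, relMatrix (R i) * J k = P k i • J k := by
    intro i
    rw [hP, Finset.sum_mul, Finset.sum_eq_single k]
    · rw [smul_mul_assoc, hJJ]
    · intro l _ hl
      rw [smul_mul_assoc, hJ0 l k hl, smul_zero]
    · simp
  have hJ : J k = (Fintype.card X : ℂ)⁻¹ • ∑ i, Q i k • relMatrix (R i) := by
    rw [hsum, smul_smul, inv_mul_cancel₀ hX, one_smul]
  -- The idempotents are not assumed Hermitian. Since `J k` is a combination of Hermitian matrices
  -- `D i` that act on `J k` as scalars, `(J k)ᴴ * J k` is a multiple of `J k`. The next steps show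
  -- that the scalar `c` is 1.
  obtain ⟨c, hc⟩ : ∃ c : ℂ, (J k).conjTranspose * J k = c • J k := by
    refine ⟨(Fintype.card X : ℂ)⁻¹ * ∑ i, star (Q i k) * P k i, ?_⟩
    nth_rw 1 [hJ]
    simp only [Matrix.conjTranspose_smul, Matrix.conjTranspose_sum,
      relMatrix_conjTranspose (hsymm _), smul_mul_assoc, Finset.sum_mul, hD, smul_smul,
      ← Finset.sum_smul]
    simp
  have hc0 : c ≠ 0 := by
    rintro rfl
    rw [zero_smul, Matrix.conjTranspose_mul_self_eq_zero] at hc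
    exact hne hc
  -- `(J k)ᴴ * J k` is its own conjugate transpose.
  have hc' : star c • (J k).conjTranspose = c • J k := by
    rw [← Matrix.conjTranspose_smul, ← hc, Matrix.conjTranspose_mul,
      Matrix.conjTranspose_conjTranspose]
  have hsc : star c ≠ 0 := star_ne_zero.mpr hc0
  have hH : (J k).conjTranspose = ((star c)⁻¹ * c) • J k := by
    rw [mul_smul, ← hc', smul_smul, inv_mul_cancel₀ hsc, one_smul]
  -- Substituting `hH` into `hc` and using `J k * J k = J k` gives `c / star c = c`, hence `star c =
  -- 1`.
  have hc1 : c = 1 * star c := by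
    have h2 : ((star c)⁻¹ * c) • J k = c • J k := by
      rw [← hc, hH, smul_mul_assoc, hJJ]
    have h3 := smul_left_injective ℂ hne h2
    have h4 : (star c)⁻¹ = 1 := mul_right_cancel₀ hc0 (h3.trans (one_mul c).symm)
    have h5 : star c = 1 := inv_eq_one.mp h4
    rw [h5, ← star_star c, h5, star_one, mul_one]
  refine ⟨J k, ?_⟩
  have : (J k).conjTranspose = J k := by
    rw [hH]
    nth_rw 2 [hc1]
    rw [one_mul, inv_mul_cancel₀ hsc, one_smul]
  rw [hsum, this, hJJ]

/-- The identity matrix has eigenvalue 1 on every `J i`. This makes the transforms of a feasible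
point of the linear program have a known sum. -/
theorem IsEigenmatrixPair.apply_eq_one {R : ι → X → X → Prop} {P Q : Matrix ι ι ℂ}
    (h : IsEigenmatrixPair R P Q) {k : ι} (hk : ∀ x y, R k x y ↔ x = y) (i : ι) : P i k = 1 := by
  obtain ⟨⟨J, hJJ, hJ0, hli, -, hP⟩, -, -⟩ := h
  have h1 : relMatrix (R k) = 1 := by
    classical
    ext x y
    simp [relMatrix, hk, Matrix.one_apply]
  have h2 : relMatrix (R k) * J i = P i k • J i := by
    rw [hP, Finset.sum_mul, Finset.sum_eq_single i]
    · rw [smul_mul_assoc, hJJ]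
    · intro l _ hl
      rw [smul_mul_assoc, hJ0 l i hl, smul_zero]
    · simp
  rw [h1, one_mul] at h2
  exact smul_left_injective ℂ (hli.ne_zero i) (h2.symm.trans (one_smul ℂ _).symm)

/-- Inversion of the product transform with kernel `Q` by the one with kernel `P`. -/
theorem sum_prod_mul_sum_prod_mul_eq {κ : Type*} [Fintype κ] [DecidableEq κ] {P Q : Matrix ι ι ℂ}
    {q : ℂ} (h : Q * P = q • (1 : Matrix ι ι ℂ)) (A : (κ → ι) → ℂ) (i : κ → ι) :
    ∑ k : κ → ι, (∏ j, P (k j) (i j)) * ∑ l : κ → ι, (∏ j, Q (l j) (k j)) * A l =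
      q ^ Fintype.card κ * A i := by
  -- For fixed `l` the sum over `k` factors over the coordinates into entries of `Q * P`, so only `l
  -- = i` survives.
  have h1 : ∀ l : κ → ι, ∑ k : κ → ι, (∏ j, P (k j) (i j)) * ((∏ j, Q (l j) (k j)) * A l) =
      (∏ j, (Q * P) (l j) (i j)) * A l := by
    intro l
    simp only [Matrix.mul_apply, Fintype.prod_sum, Finset.prod_mul_distrib, Finset.sum_mul]
    exact Finset.sum_congr rfl fun k _ => by ring
  simp only [Finset.mul_sum]
  rw [Finset.sum_comm]
  simp only [h1, h]
  rw [Finset.sum_eq_single i]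
  · simp [Finset.prod_const]
  · intro l _ hl
    obtain ⟨j, hj⟩ := Function.ne_iff.mp hl
    rw [Finset.prod_eq_zero (Finset.mem_univ j), zero_mul]
    simp [hj]
  · simp

end Eigenmatrix

/-! ### The Johnson scheme -/

theorem johnsonRel_symm {n w : ℕ} (k : Fin (w + 1)) (x y : JohnsonPoint n w)
    (h : johnsonRel n w k x y) : johnsonRel n w k y x := by
  simp only [johnsonRel] at h ⊢
  rw [hammingDist_comm, h]

theorem johnsonRel_zero_iff {n w : ℕ} (x y : JohnsonPoint n w) :
    johnsonRel n w 0 x y ↔ x = y := by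
  simp [johnsonRel, Subtype.ext_iff]

theorem exists_johnsonRel {n w : ℕ} (x y : JohnsonPoint n w) : ∃ k, johnsonRel n w k x y := by
  obtain ⟨h1, h2, h3, h4⟩ := johnsonPoint_cells x y
  beta_reduce at h1 h2 h3 h4
  -- Equal weights force the cells `(1, 0)` and `(0, 1)` to have the same size, at most `w`, and the
  -- distance is the sum of the two sizes.
  refine ⟨⟨(Finset.univ.filter fun a => (x.1 a, y.1 a) = (1, 0)).card, by omega⟩, ?_⟩
  simp only [johnsonRel]
  omega

theorem johnsonRel_unique {n w : ℕ} {k l : Fin (w + 1)} {x y : JohnsonPoint n w}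
    (h1 : johnsonRel n w k x y) (h2 : johnsonRel n w l x y) : k = l := by
  simp only [johnsonRel] at h1 h2
  ext
  omega

theorem johnsonPoint_nonempty {n w : ℕ} (h : w ≤ n) : Nonempty (JohnsonPoint n w) := by
  obtain ⟨s, -, hs⟩ := Finset.exists_subset_card_eq (s := (Finset.univ : Finset (Fin n)))
    (n := w) (by simpa using h)
  exact ⟨fun a => if a ∈ s then (1 : ZMod 2) else 0, by simp [hammingNorm, hs]⟩

/-! ### Distance distributions of multiply constant-weight codes -/

theorem hammingDist_eq_sum_blocks {m n : ℕ} (u v : Fin m × Fin n → ZMod 2) :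
    hammingDist u v = ∑ j, hammingDist (fun x => u (j, x)) (fun x => v (j, x)) := by
  simp only [hammingDist, Finset.card_filter, Fintype.sum_prod_type]

section Code

variable {m n d w : ℕ} {C : Finset (Fin m × Fin n → ZMod 2)}

/-- The blocks of a codeword. -/
def IsMCWC.block (hC : IsMCWC m n d w C) (c : C) (j : Fin m) : JohnsonPoint n w :=
  ⟨fun x => c.1 (j, x), hC.1 c.1 c.2 j⟩

/-- A product of 0/1 entries is the indicator that all the block conditions hold. In this form the
sum over `i` can be exchanged with the product over blocks. -/
theorem IsMCWC.mcwcDistr_eq (hC : IsMCWC m n d w C) (i : Fin m → Fin (w + 1)) :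
    (mcwcDistr w C i : ℂ) = (1 / (C.card : ℂ)) * ∑ c : C, ∑ c' : C,
      ∏ j, relMatrix (johnsonRel n w (i j)) (hC.block c j) (hC.block c' j) := by
  classical
  simp only [mcwcDistr]
  push_cast
  congr 1
  rw [← Finset.sum_coe_sort C]
  refine Finset.sum_congr rfl fun c _ => ?_
  rw [Finset.card_filter]
  push_cast
  rw [← Finset.sum_coe_sort C]
  refine Finset.sum_congr rfl fun c' _ => ?_
  simp only [relMatrix, Matrix.of_apply]
  rw [Finset.prod_ite_zero]
  simp [johnsonRel, IsMCWC.block, hammingDist_comm]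

theorem IsMCWC.delsarteIneq (hC : IsMCWC m n d w C) {P Q : Matrix (Fin (w + 1)) (Fin (w + 1)) ℂ}
    (hPQ : IsEigenmatrixPair (johnsonRel n w) P Q) : DelsarteIneq Q (mcwcDistr w C) := by
  intro k
  choose N hN using fun k => hPQ.exists_sum_eq_conjTranspose_mul_self johnsonRel_symm k
  have h : ∑ i : Fin m → Fin (w + 1), (∏ j, Q (i j) (k j)) * (mcwcDistr w C i : ℂ) =
      (1 / (C.card : ℂ)) * ((Fintype.card (JohnsonPoint n w) : ℂ) ^ m * ∑ c : C, ∑ c' : C,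
        ∏ j, ((N (k j)).conjTranspose * N (k j)) (hC.block c j) (hC.block c' j)) := by
    -- For a fixed pair of codewords the sum over `i` factors over the blocks, and each factor is an
    -- entry of `|X| • (Nᴴ * N)`.
    have h1 : ∀ c c' : C, (Fintype.card (JohnsonPoint n w) : ℂ) ^ m *
        ∏ j, ((N (k j)).conjTranspose * N (k j)) (hC.block c j) (hC.block c' j) =
        ∑ i : Fin m → Fin (w + 1), (∏ j, Q (i j) (k j)) *
          ∏ j, relMatrix (johnsonRel n w (i j)) (hC.block c j) (hC.block c' j) := by
      intro c c'
      simp only [← Finset.prod_mul_distrib]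
      have h2 : ∀ j, ∑ i, Q i (k j) * relMatrix (johnsonRel n w i) (hC.block c j) (hC.block c' j) =
          (Fintype.card (JohnsonPoint n w) : ℂ) *
            ((N (k j)).conjTranspose * N (k j)) (hC.block c j) (hC.block c' j) := by
        intro j
        have := congrFun (congrFun (hN (k j)) (hC.block c j)) (hC.block c' j)
        simpa only [Matrix.sum_apply, Matrix.smul_apply, smul_eq_mul] using this
      rw [← Fintype.prod_sum (fun j i => Q i (k j) *
        relMatrix (johnsonRel n w i) (hC.block c j) (hC.block c' j))]
      simp only [h2, Finset.prod_mul_distrib, Finset.prod_const, Finset.card_univ,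
        Fintype.card_fin]
    simp only [Finset.mul_sum, h1, hC.mcwcDistr_eq]
    rw [Finset.sum_comm]
    refine Finset.sum_congr rfl fun c _ => ?_
    rw [Finset.sum_comm]
    refine Finset.sum_congr rfl fun c' _ => ?_
    exact Finset.sum_congr rfl fun i _ => by ring
  rw [h]
  refine mul_nonneg ?_ (mul_nonneg ?_
    (sum_sum_prod_conjTranspose_mul_self_nonneg (fun j => N (k j)) hC.block))
  · rw [one_div, ← Complex.ofReal_natCast, ← Complex.ofReal_inv, Complex.zero_le_real]
    positivity
  · rw [← Complex.ofReal_natCast, ← Complex.ofReal_pow, Complex.zero_le_real]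
    positivity

theorem mcwcDistr_nonneg (w : ℕ) (C : Finset (Fin m × Fin n → ZMod 2))
    (i : Fin m → Fin (w + 1)) : 0 ≤ mcwcDistr w C i := by
  unfold mcwcDistr
  positivity

theorem mcwcDistr_zero (hne : C.Nonempty) : mcwcDistr w C 0 = 1 := by
  classical
  have hcard : (C.card : ℝ) ≠ 0 := by exact_mod_cast hne.card_ne_zero
  have h : ∀ c ∈ C, ((C.filter fun c₁ => ∀ j : Fin m,
      hammingDist (fun x : Fin n => c₁ (j, x)) (fun x => c (j, x)) =
        2 * ((0 : Fin m → Fin (w + 1)) j : ℕ)).card : ℝ) = 1 := by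
    intro c hc
    rw [Nat.cast_eq_one, Finset.card_eq_one]
    refine ⟨c, ?_⟩
    ext c₁
    simp only [Finset.mem_filter, Finset.mem_singleton, Pi.zero_apply, Fin.val_zero, mul_zero,
      hammingDist_eq_zero]
    constructor
    · rintro ⟨-, h⟩
      funext ⟨j, x⟩
      exact congrFun (h j) x
    · rintro rfl
      exact ⟨hc, fun _ => rfl⟩
  rw [mcwcDistr, Finset.sum_congr rfl h]
  simp [hcard]

theorem IsMCWC.mcwcDistr_eq_zero (hC : IsMCWC m n (2 * d) w C) (i : Fin m → Fin (w + 1))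
    (hi : i ≠ 0) (hid : ∑ j, (i j : ℕ) < d) : mcwcDistr w C i = 0 := by
  classical
  rw [mcwcDistr, Finset.sum_eq_zero, mul_zero]
  intro c hc
  rw [Nat.cast_eq_zero, Finset.card_eq_zero, Finset.filter_eq_empty_iff]
  intro c₁ hc₁ h
  have hdist := hammingDist_eq_sum_blocks c₁ c
  rw [Finset.sum_congr rfl fun j _ => h j, ← Finset.mul_sum] at hdist
  -- A codeword paired with itself would force `i = 0`; a distinct pair is at distance `2 * ∑ j, i j
  -- < 2 * d`.
  by_cases hcc : c₁ = c
  · subst hcc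
    apply hi
    ext j
    have := h j
    rw [hammingDist_self] at this
    simp only [Pi.zero_apply, Fin.val_zero]
    omega
  · have := hC.2 c₁ hc₁ c hc hcc
    omega

/-- In each block a pair of codewords lies in exactly one relation, so each of the `|C|²` ordered
pairs is counted once; averaging divides by `|C|`. -/
theorem IsMCWC.sum_mcwcDistr (hC : IsMCWC m n d w C) (hne : C.Nonempty) :
    ∑ i, mcwcDistr w C i = C.card := by
  classical
  have hcard : (C.card : ℂ) ≠ 0 := by exact_mod_cast hne.card_ne_zero
  have h1 : ∀ c c' : C, ∑ i : Fin m → Fin (w + 1),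
      ∏ j, relMatrix (johnsonRel n w (i j)) (hC.block c j) (hC.block c' j) = 1 := by
    intro c c'
    rw [← Fintype.prod_sum (fun j i =>
      relMatrix (johnsonRel n w i) (hC.block c j) (hC.block c' j))]
    refine Finset.prod_eq_one fun j _ => ?_
    obtain ⟨l, hl⟩ := exists_johnsonRel (hC.block c j) (hC.block c' j)
    rw [Finset.sum_eq_single l]
    · simp [relMatrix, hl]
    · intro i _ hi
      have : ¬ johnsonRel n w i (hC.block c j) (hC.block c' j) :=
        fun h => hi (johnsonRel_unique h hl)
      simp [relMatrix, this]
    · simp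
  have h2 : ((∑ i, mcwcDistr w C i : ℝ) : ℂ) = ((C.card : ℝ) : ℂ) := by
    push_cast
    simp only [hC.mcwcDistr_eq]
    rw [← Finset.mul_sum, Finset.sum_comm]
    simp only [Finset.sum_comm (s := (Finset.univ : Finset (Fin m → Fin (w + 1)))), h1]
    simp [hcard]
  exact_mod_cast h2

theorem IsMCWC.lpFeasible (hC : IsMCWC m n (2 * d) w C) (hne : C.Nonempty)
    {P Q : Matrix (Fin (w + 1)) (Fin (w + 1)) ℂ}
    (hPQ : IsEigenmatrixPair (johnsonRel n w) P Q) : LPFeasible d Q (mcwcDistr w C) :=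
  ⟨mcwcDistr_zero hne, mcwcDistr_nonneg w C, hC.mcwcDistr_eq_zero, hC.delsarteIneq hPQ⟩

theorem IsMCWC.card_sub_one_mem_lpValues (hC : IsMCWC m n (2 * d) w C) (hne : C.Nonempty)
    {P Q : Matrix (Fin (w + 1)) (Fin (w + 1)) ℂ}
    (hPQ : IsEigenmatrixPair (johnsonRel n w) P Q) :
    (C.card : ℝ) - 1 ∈ lpValues m w d Q := by
  refine ⟨mcwcDistr w C, hC.lpFeasible hne hPQ, ?_⟩
  rw [← hC.sum_mcwcDistr hne, Finset.filter_ne', ← Finset.add_sum_erase _ _ (Finset.mem_univ 0),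
    mcwcDistr_zero hne]
  ring

end Code

/-- The code consisting of a single word, with the same weight-`w` word in every block, shows that
the supremum is over a nonempty family and is at least 1; a maximiser is thus nonempty, as the
averaging requires. -/
theorem exists_isMCWC_card_eq_maxMCWC {m n w : ℕ} (d : ℕ) (h : w ≤ n) :
    ∃ C, IsMCWC m n d w C ∧ C.Nonempty ∧ C.card = maxMCWC m n d w := by
  classical
  obtain ⟨x⟩ := johnsonPoint_nonempty h
  have h1 : IsMCWC m n d w {fun p => x.1 p.2} := by
    refine ⟨fun u hu j => ?_, fun u hu v hv huv => ?_⟩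
    · rw [Finset.mem_singleton] at hu
      subst hu
      exact x.2
    · rw [Finset.mem_singleton] at hu hv
      exact absurd (hu.trans hv.symm) huv
  obtain ⟨C, hC, hCc⟩ := Finset.exists_mem_eq_sup
    (Finset.univ.filter fun C : Finset (Fin m × Fin n → ZMod 2) => IsMCWC m n d w C)
    ⟨_, Finset.mem_filter.mpr ⟨Finset.mem_univ _, h1⟩⟩ Finset.card
  have h2 := Finset.le_sup (f := Finset.card) (Finset.mem_filter.mpr ⟨Finset.mem_univ _, h1⟩)
  rw [hCc, Finset.card_singleton] at h2
  refine ⟨C, (Finset.mem_filter.mp hC).2, Finset.card_pos.mp h2, ?_⟩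
  rw [maxMCWC, ← hCc]

/-! ### The linear program attains its maximum -/

section Program

variable {m w : ℕ} {Q : Matrix (Fin (w + 1)) (Fin (w + 1)) ℂ}

theorem isClosed_setOf_lpFeasible (d : ℕ) :
    IsClosed {A : (Fin m → Fin (w + 1)) → ℝ | LPFeasible d Q A} := by
  simp only [LPFeasible, DelsarteIneq, Set.ofPred_and, Set.ofPred_forall]
  refine IsClosed.inter ?_ (IsClosed.inter ?_ (IsClosed.inter ?_ ?_))
  · exact isClosed_eq (by fun_prop) (by fun_prop)
  · exact isClosed_iInter fun i => isClosed_le (by fun_prop) (by fun_prop)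
  · exact isClosed_iInter fun i => isClosed_iInter fun _ => isClosed_iInter fun _ =>
      isClosed_eq (by fun_prop) (by fun_prop)
  · exact isClosed_iInter fun k => isClosed_le (by fun_prop) (by fun_prop)

/-- The transforms `B k` are nonnegative and sum to `q ^ m`, so each has norm at most `‖q ^ m‖`.
Recovering `q ^ m * A i` from them by `P` then bounds `A i` independently of `A`. -/
theorem LPFeasible.le_sum_norm {d : ℕ} {P : Matrix (Fin (w + 1)) (Fin (w + 1)) ℂ} {q : ℂ}
    (hq : q ≠ 0) (hQP : Q * P = q • (1 : Matrix (Fin (w + 1)) (Fin (w + 1)) ℂ))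
    (hP : ∀ i, P i 0 = 1) {A : (Fin m → Fin (w + 1)) → ℝ} (hA : LPFeasible d Q A)
    (i : Fin m → Fin (w + 1)) :
    |A i| ≤ ∑ k : Fin m → Fin (w + 1), ‖∏ j, P (k j) (i j)‖ := by
  obtain ⟨hA0, -, -, hD⟩ := hA
  set B : (Fin m → Fin (w + 1)) → ℂ := fun k => ∑ l, (∏ j, Q (l j) (k j)) * (A l : ℂ) with hB
  have hinv := sum_prod_mul_sum_prod_mul_eq hQP (fun l : Fin m → Fin (w + 1) => (A l : ℂ))
  have hB0 : ∀ k, 0 ≤ B k := hD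
  -- Inversion at `i = 0`, where every `P (k j) 0` is 1 and `A 0 = 1`.
  have hsum : ∑ k, B k = q ^ Fintype.card (Fin m) := by
    have := hinv 0
    simpa [hP, hA0] using this
  have hnorm : ∑ k, ‖B k‖ = ‖q ^ Fintype.card (Fin m)‖ := by
    have h1 : ((∑ k, ‖B k‖ : ℝ) : ℂ) = q ^ Fintype.card (Fin m) := by
      rw [← hsum]
      push_cast
      exact Finset.sum_congr rfl fun k _ => (Complex.eq_coe_norm_of_nonneg (hB0 k)).symm
    rw [← h1, Complex.norm_real, Real.norm_of_nonneg (by positivity)]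
  have hle : ∀ k, ‖B k‖ ≤ ‖q ^ Fintype.card (Fin m)‖ := by
    intro k
    rw [← hnorm]
    exact Finset.single_le_sum (f := fun k => ‖B k‖) (fun _ _ => norm_nonneg _)
      (Finset.mem_univ k)
  have hpos : 0 < ‖q ^ Fintype.card (Fin m)‖ := norm_pos_iff.mpr (pow_ne_zero _ hq)
  refine le_of_mul_le_mul_left ?_ hpos
  calc ‖q ^ Fintype.card (Fin m)‖ * |A i|
      = ‖∑ k : Fin m → Fin (w + 1), (∏ j, P (k j) (i j)) * B k‖ := by
        rw [hinv i, norm_mul, Complex.norm_real, Real.norm_eq_abs]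
    _ ≤ ∑ k : Fin m → Fin (w + 1), ‖q ^ Fintype.card (Fin m)‖ * ‖∏ j, P (k j) (i j)‖ := by
        refine norm_sum_le_of_le _ fun k _ => ?_
        rw [norm_mul, mul_comm]
        exact mul_le_mul_of_nonneg_right (hle k) (norm_nonneg _)
    _ = _ := (Finset.mul_sum _ _ _).symm

theorem isCompact_setOf_lpFeasible (d : ℕ) {P : Matrix (Fin (w + 1)) (Fin (w + 1)) ℂ} {q : ℂ}
    (hq : q ≠ 0) (hQP : Q * P = q • (1 : Matrix (Fin (w + 1)) (Fin (w + 1)) ℂ))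
    (hP : ∀ i, P i 0 = 1) :
    IsCompact {A : (Fin m → Fin (w + 1)) → ℝ | LPFeasible d Q A} := by
  refine (isCompact_univ_pi fun i => isCompact_Icc).of_isClosed_subset
    (isClosed_setOf_lpFeasible d) (fun A hA i _ => abs_le.mp (hA.le_sum_norm hq hQP hP i))

end Program

/-! ### The Delsarte inequalities and the linear programming bound -/

theorem mainTheorem6 (m n d w : ℕ) (hw : 1 ≤ w) (hwn : 2 * w ≤ n)
    (P Q : Matrix (Fin (w + 1)) (Fin (w + 1)) ℂ)
    (hPQ : IsEigenmatrixPair (johnsonRel n w) P Q) :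
    (∀ C : Finset (Fin m × Fin n → ZMod 2), C.Nonempty → IsMCWC m n (2 * d) w C →
      DelsarteIneq Q (mcwcDistr w C)) ∧
    ∃ v : ℝ, IsGreatest (lpValues m w d Q) v ∧ (maxMCWC m n (2 * d) w : ℤ) ≤ 1 + ⌊v⌋ := by
  refine ⟨fun C _ hC => hC.delsarteIneq hPQ, ?_⟩
  obtain ⟨C, hC, hne, hcard⟩ := exists_isMCWC_card_eq_maxMCWC (m := m) (2 * d)
    (show w ≤ n by omega)
  have hmem := hC.card_sub_one_mem_lpValues hne hPQ
  have hX : (Fintype.card (JohnsonPoint n w) : ℂ) ≠ 0 := by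
    have := johnsonPoint_nonempty (show w ≤ n by omega)
    exact_mod_cast Fintype.card_ne_zero
  -- The values are the image of the compact feasible set under a continuous linear functional.
  have hcomp : IsCompact (lpValues m w d Q) := by
    have h := (isCompact_setOf_lpFeasible (m := m) d hX hPQ.2.2
      (hPQ.apply_eq_one johnsonRel_zero_iff)).image
      (f := fun A => ∑ i ∈ Finset.univ.filter (fun i => i ≠ 0), A i) (by fun_prop)
    convert h using 1
    ext v
    simp only [lpValues, Set.mem_ofPred_eq, Set.mem_image, eq_comm]
  obtain ⟨v, hv⟩ := hcomp.exists_isGreatest ⟨_, hmem⟩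
  refine ⟨v, hv, ?_⟩
  -- `|C| - 1` is an integer below `v`, so it is also below the floor.
  have h1 : ((C.card : ℤ) - 1 : ℤ) ≤ ⌊v⌋ := by
    rw [Int.le_floor]
    push_cast
    exact hv.2 hmem
  rw [← hcard]
  linarith
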